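/- Let $a\in(0,2]$ be a fixed real number and, for integers $n\ge 2$, let $T_n(x)=x^n-ax-1$. Let $P_n$ be the product of those complex roots of $T_n$, counted with multiplicity, whose modulus is greater than $1$. Then $P_n$ is equal to the Mahler measure $M(T_n)=\exp\left(\int_0^1\ln|T_n(e^{2\pi i\theta})|\,d\theta\right)=\prod_{i=1}^{n}\max(|\alpha_i|,1)$, where $\alpha_1,\dots,\alpha_n$ are the complex roots of $T_n$ with multiplicity, and \[ \lim_{n\to\infty}P_n=\exp\left(\frac{1}{2\pi}\int_0^{\arccos(-a/2)}\ln(1+a^2+2a\cos t)\,dt\right). \] -/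

import Mathlib

open Polynomial in
/-- The trinomial `x ^ n - a x - 1`, as a polynomial over `ℂ`. -/
noncomputable def unitTrinomial (a : ℝ) (n : ℕ) : ℂ[X] :=
  X ^ n - C (a : ℂ) * X - 1

/-- The product of the complex roots of `p`, counted with multiplicity, whose modulus is
greater than `1`. -/
noncomputable def prodRootsOutside (p : Polynomial ℂ) : ℂ :=
  (p.roots.filter fun z => 1 < ‖z‖).prod

/-! The roots outside the unit disc are stable under conjugation, and for `0 < a ≤ 2` the real ones
are positive, so their product is the product of their moduli: the Mahler measure of a monic
polynomial.

On the unit circle the trinomial is `w - z` with `w = exp (i n t)` and `z = 1 + a exp (i t)`. As `n`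
grows, `w` oscillates independently of `z`, and the mean of `log ‖w - z‖` over the circle of `w` is
`log⁺ ‖z‖`. To make this precise, write `‖w - z‖ = max 1 ‖z‖ * ‖1 - w g‖` with `‖g‖ < 1` and expand
`log ‖1 - w g‖` in powers of `w g`. Each term dies by Riemann–Lebesgue, and the series is dominated
because `log (1 - ‖g‖)` is integrable. Finally `‖z‖ > 1` exactly when `cos t > -a / 2`, which gives
the arccosine. -/

open Polynomial in
theorem unitTrinomial_monic (a : ℝ) {n : ℕ} (hn : 2 ≤ n) : (unitTrinomial a n).Monic := by
  rw [unitTrinomial, sub_sub]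
  refine monic_X_pow_sub (n := n) ?_
  refine (degree_add_le _ _).trans_lt (max_lt ?_ ?_)
  · refine (degree_C_mul_X_le _).trans_lt ?_
    exact_mod_cast (by omega : 1 < n)
  · refine degree_one_le.trans_lt ?_
    exact_mod_cast (by omega : 0 < n)

/-! ### Conjugation symmetry and positivity of the product. -/

open Polynomial ComplexConjugate in
theorem unitTrinomial_roots_map_conj (a : ℝ) (n : ℕ) :
    (unitTrinomial a n).roots.map conj = (unitTrinomial a n).roots := by
  rw [← (IsAlgClosed.splits (unitTrinomial a n)).roots_map (starRingEnd ℂ)]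
  simp [unitTrinomial]

open ComplexConjugate in
/-- A multiset of complex numbers that is stable under conjugation and whose real members are
nonnegative has a nonnegative real product. -/
theorem Multiset.prod_eq_prod_norm_of_map_conj {s : Multiset ℂ} (hs : s.map conj = s)
    (hpos : ∀ z ∈ s, z.im = 0 → 0 ≤ z.re) : s.prod = ((s.map norm).prod : ℝ) := by
  have hneg : s.filter (fun z => z.im < 0) = (s.filter fun z => 0 < z.im).map conj := by
    conv_lhs => rw [← hs]
    rw [Multiset.filter_map]
    simp
  have hsplit : s = s.filter (fun z => z.im = 0) +
      (s.filter (fun z => 0 < z.im) + s.filter fun z => z.im < 0) := by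
    conv_lhs => rw [← Multiset.filter_add_not (fun z : ℂ => z.im = 0) s,
      ← Multiset.filter_add_not (fun z : ℂ => 0 < z.im) (s.filter fun z => ¬ z.im = 0)]
    rw [Multiset.filter_filter, Multiset.filter_filter]
    congr 2 <;> refine Multiset.filter_congr fun z _ => ?_ <;> grind
  have hreal : (s.filter fun z => z.im = 0).prod =
      (((s.filter fun z => z.im = 0).map norm).prod : ℝ) := by
    rw [← Complex.ofRealHom_eq_coe, map_multiset_prod, Multiset.map_map]
    conv_lhs => rw [← Multiset.map_id (s.filter fun z => z.im = 0)]
    congr 1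
    refine Multiset.map_congr rfl fun z hz => ?_
    obtain ⟨hz, him⟩ := Multiset.mem_filter.1 hz
    have : z = (z.re : ℂ) := Complex.ext rfl (by simp [him])
    rw [id, Function.comp_apply, Complex.ofRealHom_eq_coe]
    conv_rhs => rw [this, Complex.norm_real, Real.norm_of_nonneg (hpos z hz him)]
    exact this
  have hnorm : ∀ t : Multiset ℂ, (t.map norm).prod = ‖t.prod‖ := fun t =>
    (map_multiset_prod (normHom (α := ℂ)) t).symm
  rw [hnorm] at hreal ⊢
  rw [hsplit, Multiset.prod_add, Multiset.prod_add, hneg, ← map_multiset_prod (starRingEnd ℂ),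
    Complex.mul_conj', norm_mul, Complex.ofReal_mul, ← hreal]
  simp

theorem Multiset.prod_map_max_one_norm (s : Multiset ℂ) :
    (s.map fun z => max 1 ‖z‖).prod = ((s.filter fun z => 1 < ‖z‖).map norm).prod := by
  induction s using Multiset.induction with
  | empty => simp
  | cons z s ih =>
    by_cases hz : 1 < ‖z‖
    · simp [hz, ih, hz.le]
    · simp [hz, ih, not_lt.1 hz]

/-- For a root `-y` with `y > 1`: if `n` is even, `y ^ n = 1 - a y < 1`; if `n` is odd, `y ^ 3 ≤ y ^
n = a y - 1 ≤ 2 y - 1`, against `y ^ 3 - 2 y + 1 = (y - 1) (y ^ 2 + y - 1) > 0`. -/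
theorem unitTrinomial_real_root_nonneg {a : ℝ} (ha : a ∈ Set.Ioc (0 : ℝ) 2) {n : ℕ} (hn : 2 ≤ n)
    {x : ℝ} (hx : 1 < |x|) (hroot : x ^ n = a * x + 1) : 0 ≤ x := by
  by_contra! hneg
  obtain ⟨ha0, ha2⟩ := ha
  rw [abs_of_neg hneg] at hx
  obtain ⟨y, rfl⟩ : ∃ y, x = -y := ⟨-x, by simp⟩
  rw [neg_neg] at hx
  rcases n.even_or_odd with he | ho
  · have h1 : 1 < y ^ n := one_lt_pow₀ hx (by omega)
    rw [he.neg_pow] at hroot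
    nlinarith
  · have h3 : 3 ≤ n := by
      rcases ho with ⟨k, rfl⟩; omega
    have h1 : y ^ 3 ≤ y ^ n := pow_le_pow_right₀ hx.le h3
    rw [ho.neg_pow] at hroot
    have h4 : y ^ 3 ≤ 2 * y - 1 := by nlinarith
    nlinarith [mul_pos (sub_pos.2 hx) (sub_pos.2 hx)]

theorem prodRootsOutside_unitTrinomial {a : ℝ} (ha : a ∈ Set.Ioc (0 : ℝ) 2) {n : ℕ} (hn : 2 ≤ n) :
    prodRootsOutside (unitTrinomial a n) = ((unitTrinomial a n).mahlerMeasure : ℂ) := by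
  rw [Polynomial.mahlerMeasure_eq_leadingCoeff_mul_prod_roots,
    (unitTrinomial_monic a hn).leadingCoeff, norm_one, one_mul, Multiset.prod_map_max_one_norm,
    prodRootsOutside]
  refine Multiset.prod_eq_prod_norm_of_map_conj ?_ fun z hz him => ?_
  · conv_rhs => rw [← unitTrinomial_roots_map_conj]
    rw [Multiset.filter_map]
    simp
  · obtain ⟨hz, hnorm⟩ := Multiset.mem_filter.1 hz
    have hre : z = (z.re : ℂ) := Complex.ext rfl (by simp [him])
    have hroot := (Polynomial.mem_roots'.1 hz).2
    rw [hre] at hroot hnorm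
    refine unitTrinomial_real_root_nonneg ha hn (by simpa using hnorm) ?_
    simp only [unitTrinomial, Polynomial.IsRoot.def, Polynomial.eval_sub, Polynomial.eval_pow,
      Polynomial.eval_X, Polynomial.eval_mul, Polynomial.eval_C, Polynomial.eval_one] at hroot
    have h : z.re ^ n - a * z.re - 1 = 0 := by exact_mod_cast hroot
    linarith

/-! ### Oscillatory integrals. -/

-- Riemann–Lebesgue at frequency `-n k / (2 π)`. No integrability of `f` is needed: otherwise every
-- integral is `0` by convention.
open MeasureTheory Filter Topology in
theorem tendsto_setIntegral_exp_nat_mul_I_mul {s : Set ℝ} (hs : MeasurableSet s) (f : ℝ → ℂ)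
    {k : ℕ} (hk : k ≠ 0) :
    Tendsto (fun n : ℕ => ∫ t in s, Complex.exp (n * t * Complex.I) ^ k * f t) atTop (𝓝 0) := by
  have hw : Tendsto (fun n : ℕ => -((n : ℝ) * (k / (2 * Real.pi)))) atTop (cocompact ℝ) := by
    refine (tendsto_neg_atTop_atBot.comp ?_).mono_right atBot_le_cocompact
    exact tendsto_natCast_atTop_atTop.atTop_mul_const (by positivity)
  refine ((Real.tendsto_integral_exp_smul_cocompact (s.indicator f)).comp hw).congr fun n => ?_
  rw [Function.comp_apply, ← integral_indicator hs]
  refine integral_congr_ae (Eventually.of_forall fun t => ?_)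
  by_cases ht : t ∈ s
  · simp only [Set.indicator_of_mem ht, Circle.smul_def, Real.fourierChar_apply, smul_eq_mul,
      ← Complex.exp_nat_mul]
    congr 2
    push_cast
    field_simp
  · simp [Set.indicator_of_notMem ht]

open MeasureTheory Filter Topology in
/-- If `‖g‖ < 1` almost everywhere on `s` and `log (1 - ‖g‖)` is integrable there, then the
integrals over `s` of `log ‖1 - exp (i n t) g t‖` tend to `0`. -/
theorem tendsto_setIntegral_log_norm_one_sub_exp_mul {s : Set ℝ} (hs : MeasurableSet s) {g : ℝ → ℂ}
    (hg : AEStronglyMeasurable g (volume.restrict s))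
    (hlt : ∀ᵐ t ∂volume.restrict s, ‖g t‖ < 1)
    (hint : IntegrableOn (fun t => Real.log (1 - ‖g t‖)) s) :
    Tendsto (fun n : ℕ => ∫ t in s, Real.log ‖1 - Complex.exp (n * t * Complex.I) * g t‖)
      atTop (𝓝 0) := by
  have hser : ∀ᵐ t ∂volume.restrict s,
      HasSum (fun k : ℕ => ‖g t‖ ^ (k + 1) / (k + 1)) (-Real.log (1 - ‖g t‖)) := by
    filter_upwards [hlt] with t ht
    exact Real.hasSum_pow_div_log_of_abs_lt_one (by rwa [abs_norm])
  have hterm : ∀ k : ℕ, IntegrableOn (fun t => ‖g t‖ ^ (k + 1) / (k + 1)) s := fun k => by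
    simp_rw [div_eq_mul_inv]
    refine Integrable.mono' hint.neg ((hg.norm.pow _).mul_const _) ?_
    filter_upwards [hser] with t ht
    rw [Real.norm_of_nonneg (by positivity), ← div_eq_mul_inv]
    exact le_hasSum ht k fun j _ => by positivity
  -- Partial sums stay below the integral of `-log (1 - ‖g‖)`. This one series dominates uniformly
  -- in `n`, since `exp (i n t)` has modulus `1`.
  have hsum : Summable fun k : ℕ => ∫ t in s, ‖g t‖ ^ (k + 1) / (k + 1) := by
    refine summable_of_sum_range_le (c := ∫ t in s, -Real.log (1 - ‖g t‖))
      (fun k => integral_nonneg fun t => by positivity) fun N => ?_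
    rw [← integral_finsetSum _ fun k _ => hterm k]
    refine integral_mono_ae (integrable_finsetSum _ fun k _ => hterm k) hint.neg ?_
    filter_upwards [hser] with t ht
    exact sum_le_hasSum _ (fun j _ => by positivity) ht
  let F : ℕ → ℕ → ℝ → ℂ := fun n k t =>
    (Complex.exp (n * t * Complex.I) * g t) ^ (k + 1) / (k + 1)
  have hexp : ∀ (n : ℕ) (t : ℝ), ‖Complex.exp (n * t * Complex.I)‖ = 1 := fun n t => by
    exact_mod_cast Complex.norm_exp_ofReal_mul_I (n * t)
  have hFnorm : ∀ n k t, ‖F n k t‖ = ‖g t‖ ^ (k + 1) / (k + 1) := fun n k t => by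
    have : ‖(k : ℂ) + 1‖ = k + 1 := by exact_mod_cast Complex.norm_natCast (k + 1)
    simp [F, hexp, this]
  have hFint : ∀ n k, IntegrableOn (F n k) s := fun n k => by
    refine Integrable.mono' (hterm k) ?_ (Eventually.of_forall fun t => (hFnorm n k t).le)
    simp_rw [F, div_eq_mul_inv]
    refine ((AEStronglyMeasurable.mul ?_ hg).pow _).mul_const _
    exact (by fun_prop : Continuous fun t : ℝ =>
      Complex.exp (n * t * Complex.I)).aestronglyMeasurable
  have hFre : ∀ n k, ∫ t in s, (F n k t).re = (∫ t in s, F n k t).re := fun n k =>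
    integral_re (hFint n k)
  have hFreint : ∀ n k, IntegrableOn (fun t => (F n k t).re) s := fun n k => (hFint n k).re
  have hbound : ∀ n k, ∫ t in s, ‖(F n k t).re‖ ≤ ∫ t in s, ‖g t‖ ^ (k + 1) / (k + 1) :=
    fun n k => integral_mono (hFreint n k).norm (hterm k) fun t =>
      (Complex.abs_re_le_norm _).trans (hFnorm n k t).le
  have hlog : ∀ n : ℕ, -∑' k, ∫ t in s, (F n k t).re =
      ∫ t in s, Real.log ‖1 - Complex.exp (n * t * Complex.I) * g t‖ := fun n => by
    rw [(hasSum_integral_of_summable_integral_norm (hFreint n)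
      (hsum.of_nonneg_of_le (fun k => integral_nonneg fun t => norm_nonneg _) (hbound n))).tsum_eq,
      ← integral_neg]
    refine integral_congr_ae ?_
    filter_upwards [hlt] with t ht
    have := Complex.hasSum_re (Complex.hasSum_taylorSeries_neg_log'
      (z := Complex.exp (n * t * Complex.I) * g t) (by simpa [hexp] using ht))
    rw [this.tsum_eq, Complex.neg_re, Complex.log_re, neg_neg]
  have hlim := tendsto_tsum_of_dominated_convergence (𝓕 := atTop) (g := fun _ : ℕ => (0 : ℝ))
    (f := fun n k => ∫ t in s, (F n k t).re) hsum (fun k => ?_)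
    (Eventually.of_forall fun n k => (norm_integral_le_integral_norm _).trans (hbound n k))
  · simpa [hlog] using hlim.neg
  · have h0 := tendsto_setIntegral_exp_nat_mul_I_mul hs (fun t => g t ^ (k + 1) / (k + 1))
      k.succ_ne_zero
    simp_rw [hFre]
    have := (Complex.continuous_re.tendsto 0).comp h0
    simpa [F, mul_pow, mul_div_assoc, Function.comp_def] using this

/-! ### The curve `1 + a exp (i t)` and its fold into the disc. -/

theorem norm_one_add_mul_exp_sq (a t : ℝ) :
    ‖1 + a * Complex.exp (t * Complex.I)‖ ^ 2 = 1 + a ^ 2 + 2 * a * Real.cos t := by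
  rw [Complex.exp_mul_I, Complex.sq_norm, Complex.normSq_apply]
  simp only [← Complex.ofReal_cos, ← Complex.ofReal_sin, Complex.add_re, Complex.add_im,
    Complex.mul_re, Complex.mul_im, Complex.ofReal_re, Complex.ofReal_im, Complex.one_re,
    Complex.one_im, Complex.I_re, Complex.I_im]
  nlinarith [Real.sin_sq_add_cos_sq t]

theorem countable_setOf_cos_eq (c : ℝ) : {t : ℝ | Real.cos t = c}.Countable := by
  rcases Set.eq_empty_or_nonempty {t : ℝ | Real.cos t = c} with h | ⟨u, rfl⟩
  · simp [h]
  · refine ((Set.countable_range fun k : ℤ => 2 * k * Real.pi + u).union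
      (Set.countable_range fun k : ℤ => 2 * k * Real.pi - u)).mono fun t ht => ?_
    have ht : Real.cos t = Real.cos u := ht
    obtain ⟨k, hk | hk⟩ := Real.cos_eq_cos_iff.1 ht.symm
    · exact Or.inl ⟨k, hk.symm⟩
    · exact Or.inr ⟨k, hk.symm⟩

open MeasureTheory in
theorem ae_norm_one_add_mul_exp_ne_one {a : ℝ} (ha : a ≠ 0) (s : Set ℝ) :
    ∀ᵐ t : ℝ ∂volume.restrict s, ‖1 + a * Complex.exp (t * Complex.I)‖ ≠ 1 := by
  refine ae_restrict_of_ae ?_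
  filter_upwards [(countable_setOf_cos_eq (-a / 2)).ae_notMem volume] with t ht h
  refine ht ?_
  have h2 := norm_one_add_mul_exp_sq a t
  rw [h] at h2
  have : a * (a + 2 * Real.cos t) = 0 := by linarith
  have := (mul_eq_zero.1 this).resolve_left ha
  show Real.cos t = -a / 2
  linarith

/-- The point of the closed unit disc obtained from `z` by reflection in the real axis if
`‖z‖ ≤ 1`, and by inversion otherwise. -/
noncomputable def foldToDisc (z : ℂ) : ℂ :=
  if 1 < ‖z‖ then z⁻¹ else starRingEnd ℂ z

theorem measurable_foldToDisc : Measurable foldToDisc := by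
  refine Measurable.ite (measurableSet_lt measurable_const measurable_norm) measurable_inv ?_
  exact Complex.continuous_conj.measurable

theorem norm_foldToDisc_lt_one {z : ℂ} (hz : ‖z‖ ≠ 1) : ‖foldToDisc z‖ < 1 := by
  unfold foldToDisc
  split_ifs with h
  · rw [norm_inv]
    exact inv_lt_one_of_one_lt₀ h
  · rw [Complex.norm_conj]
    exact lt_of_le_of_ne (not_lt.1 h) hz

/-- Outside the disc, factor out `z`. Inside, replace `1` by `w * conj w` and conjugate, which is
why the fold reflects there. -/
theorem norm_sub_eq_max_mul_norm_one_sub_mul_foldToDisc {w : ℂ} (hw : ‖w‖ = 1) (z : ℂ) :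
    ‖w - z‖ = max 1 ‖z‖ * ‖1 - w * foldToDisc z‖ := by
  unfold foldToDisc
  split_ifs with h
  · have hz : z ≠ 0 := norm_pos_iff.1 (zero_lt_one.trans h)
    rw [max_eq_right h.le, ← norm_mul, mul_sub, mul_one, mul_left_comm, mul_inv_cancel₀ hz,
      mul_one, norm_sub_rev]
  · have hww : w * starRingEnd ℂ w = 1 := by simp [Complex.mul_conj', hw]
    rw [max_eq_left (not_lt.1 h), one_mul, ← hww, ← mul_sub, norm_mul, hw, one_mul, ← map_sub,
      Complex.norm_conj]

/-- With `r = ‖z‖`, the left side is `1 - ‖foldToDisc z‖` times `r (r + 1)` if `r > 1`, and times `r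
+ 1` if `r ≤ 1`. It bounds `1 - ‖foldToDisc z‖` below by a quantity analytic along the curve. -/
theorem abs_norm_sq_sub_one_le (z : ℂ) :
    |‖z‖ ^ 2 - 1| ≤ (1 + ‖z‖) ^ 2 * (1 - ‖foldToDisc z‖) := by
  have h0 := norm_nonneg z
  unfold foldToDisc
  split_ifs with h
  · have hz : ‖z‖ * ‖z‖⁻¹ = 1 := mul_inv_cancel₀ (by positivity)
    have hi : ‖z‖⁻¹ < 1 := inv_lt_one_of_one_lt₀ h
    rw [norm_inv, abs_of_nonneg (by nlinarith)]
    nlinarith [mul_pos (sub_pos.2 h) (sub_pos.2 hi)]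
  · rw [Complex.norm_conj, abs_of_nonpos (by nlinarith)]
    nlinarith [mul_nonneg (mul_nonneg h0 h0) (sub_nonneg.2 (not_lt.1 h)),
      mul_nonneg h0 (sub_nonneg.2 (not_lt.1 h))]

-- The singularities sit where `‖z‖ = 1`. They are controlled by `log |‖z‖ ^ 2 - 1|`, and `‖z‖ ^ 2 -
-- 1 = a (a + 2 cos t)` is analytic, so that its log is integrable. The constant `2 + |a|` bounds `1
-- + ‖z‖`.
open MeasureTheory in
theorem integrableOn_log_one_sub_norm_foldToDisc {a : ℝ} (ha : a ≠ 0) :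
    IntegrableOn (fun t : ℝ =>
      Real.log (1 - ‖foldToDisc (1 + a * Complex.exp (t * Complex.I))‖))
      (Set.Ioc 0 (2 * Real.pi)) := by
  have hcos : IntegrableOn (fun t : ℝ => Real.log (a * (a + 2 * Real.cos t)))
      (Set.Ioc 0 (2 * Real.pi)) := by
    rw [← intervalIntegrable_iff_integrableOn_Ioc_of_le Real.two_pi_pos.le]
    refine MeromorphicOn.intervalIntegrable_log
      (f := fun t : ℝ => a * (a + 2 * Real.cos t)) fun t _ => AnalyticAt.meromorphicAt ?_
    have := Real.analyticAt_cos (x := t)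
    fun_prop
  refine Integrable.mono' (g := fun t : ℝ =>
    |Real.log (a * (a + 2 * Real.cos t))| + Real.log ((2 + |a|) ^ 2))
    (hcos.abs.add (integrableOn_const measure_Ioc_lt_top.ne)) ?_ ?_
  · refine Measurable.aestronglyMeasurable (Real.measurable_log.comp (measurable_const.sub
      (measurable_norm.comp (measurable_foldToDisc.comp ?_))))
    exact Continuous.measurable (by fun_prop)
  · filter_upwards [ae_norm_one_add_mul_exp_ne_one ha (Set.Ioc 0 (2 * Real.pi))] with t ht
    set z : ℂ := 1 + a * Complex.exp (t * Complex.I) with hz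
    have hlt := norm_foldToDisc_lt_one ht
    have hfac : ‖z‖ ^ 2 - 1 = a * (a + 2 * Real.cos t) := by
      rw [hz, norm_one_add_mul_exp_sq]; ring
    have hne : ‖z‖ ^ 2 - 1 ≠ 0 := fun h => ht <|
      (pow_eq_one_iff_of_nonneg (norm_nonneg z) two_ne_zero).1 (sub_eq_zero.1 h)
    have hzle : ‖z‖ ≤ 1 + |a| := by
      refine (norm_add_le _ _).trans ?_
      simp [Complex.norm_exp_ofReal_mul_I]
    have hle : |‖z‖ ^ 2 - 1| ≤ (2 + |a|) ^ 2 * (1 - ‖foldToDisc z‖) := by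
      refine (abs_norm_sq_sub_one_le z).trans ?_
      have : 0 ≤ 1 - ‖foldToDisc z‖ := by linarith
      exact mul_le_mul_of_nonneg_right (pow_le_pow_left₀ (by positivity) (by linarith) 2) this
    have hlog := Real.log_le_log (abs_pos.2 hne) hle
    rw [Real.log_mul (by positivity) (by linarith), Real.log_abs, hfac] at hlog
    rw [Real.norm_of_nonpos
      (Real.log_nonpos (by linarith) (by linarith [norm_nonneg (foldToDisc z)]))]
    linarith [neg_abs_le (Real.log (a * (a + 2 * Real.cos t)))]

/-! ### The limit of the logarithmic Mahler measure. -/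

theorem eval_circleMap_unitTrinomial (a : ℝ) (n : ℕ) (t : ℝ) :
    (unitTrinomial a n).eval (circleMap 0 1 t) =
      Complex.exp (n * t * Complex.I) - (1 + a * Complex.exp (t * Complex.I)) := by
  simp only [unitTrinomial, circleMap, Polynomial.eval_sub, Polynomial.eval_pow,
    Polynomial.eval_X, Polynomial.eval_mul, Polynomial.eval_C, Polynomial.eval_one,
    Complex.ofReal_one, zero_add, one_mul, ← Complex.exp_nat_mul]
  ring_nf

open MeasureTheory in
theorem logMahlerMeasure_unitTrinomial (a : ℝ) (n : ℕ) :
    (unitTrinomial a n).logMahlerMeasure = (2 * Real.pi)⁻¹ *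
      ∫ t in Set.Ioc 0 (2 * Real.pi), Real.log ‖Complex.exp (n * t * Complex.I) -
        (1 + a * Complex.exp (t * Complex.I))‖ := by
  rw [Polynomial.logMahlerMeasure_def, Real.circleAverage_def,
    intervalIntegral.integral_of_le Real.two_pi_pos.le, smul_eq_mul]
  simp_rw [eval_circleMap_unitTrinomial]

theorem continuous_posLog_norm_one_add_mul_exp (a : ℝ) :
    Continuous fun t : ℝ => Real.posLog ‖1 + a * Complex.exp (t * Complex.I)‖ :=
  Real.continuous_posLog.comp (by fun_prop)

open MeasureTheory Filter Topology in
theorem tendsto_logMahlerMeasure_unitTrinomial {a : ℝ} (ha : a ≠ 0) :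
    Tendsto (fun n : ℕ => (unitTrinomial a n).logMahlerMeasure) atTop
      (𝓝 ((2 * Real.pi)⁻¹ * ∫ t in (0 : ℝ)..2 * Real.pi,
        Real.posLog ‖1 + a * Complex.exp (t * Complex.I)‖)) := by
  simp_rw [logMahlerMeasure_unitTrinomial]
  refine Tendsto.const_mul _ ?_
  have hmeas : Measurable fun t : ℝ => foldToDisc (1 + a * Complex.exp (t * Complex.I)) :=
    measurable_foldToDisc.comp (Continuous.measurable (by fun_prop))
  have hlim := tendsto_setIntegral_log_norm_one_sub_exp_mul measurableSet_Ioc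
    hmeas.aestronglyMeasurable
    ((ae_norm_one_add_mul_exp_ne_one ha _).mono fun t => norm_foldToDisc_lt_one)
    (integrableOn_log_one_sub_norm_foldToDisc ha)
  have hexp : ∀ (n : ℕ) (t : ℝ), ‖Complex.exp (n * t * Complex.I)‖ = 1 := fun n t => by
    exact_mod_cast Complex.norm_exp_ofReal_mul_I (n * t)
  rw [intervalIntegral.integral_of_le Real.two_pi_pos.le]
  have hpos : IntegrableOn (fun t : ℝ => Real.posLog ‖1 + a * Complex.exp (t * Complex.I)‖)
      (Set.Ioc 0 (2 * Real.pi)) :=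
    ((continuous_posLog_norm_one_add_mul_exp a).intervalIntegrable 0 (2 * Real.pi)).1
  have := hlim.const_add (∫ t in Set.Ioc 0 (2 * Real.pi),
    Real.posLog ‖1 + a * Complex.exp (t * Complex.I)‖)
  rw [add_zero] at this
  refine this.congr fun n => ?_
  have hkey : ∀ᵐ t : ℝ ∂volume.restrict (Set.Ioc 0 (2 * Real.pi)),
      Real.log ‖Complex.exp (n * t * Complex.I) - (1 + a * Complex.exp (t * Complex.I))‖ =
      Real.posLog ‖1 + a * Complex.exp (t * Complex.I)‖ +
        Real.log ‖1 - Complex.exp (n * t * Complex.I) *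
          foldToDisc (1 + a * Complex.exp (t * Complex.I))‖ := by
    filter_upwards [ae_norm_one_add_mul_exp_ne_one ha _] with t ht
    have hlt := norm_foldToDisc_lt_one ht
    rw [norm_sub_eq_max_mul_norm_one_sub_mul_foldToDisc (hexp n t), Real.log_mul (by positivity),
      Real.posLog_eq_log_max_one (norm_nonneg _)]
    refine norm_ne_zero_iff.2 fun h => hlt.ne ?_
    simpa [hexp] using (congrArg norm (sub_eq_zero.1 h)).symm
  -- The remaining log factor is integrable as a difference: the log of the trinomial minus `log⁺`,
  -- almost everywhere.
  have hI : IntegrableOn (fun t : ℝ => Real.log ‖Complex.exp (n * t * Complex.I) -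
      (1 + a * Complex.exp (t * Complex.I))‖) (Set.Ioc 0 (2 * Real.pi)) := by
    have := ((unitTrinomial a n).intervalIntegrable_mahlerMeasure).1
    simpa only [eval_circleMap_unitTrinomial] using this
  rw [← integral_add hpos, integral_congr_ae hkey]
  refine (hI.sub hpos).congr ?_
  filter_upwards [hkey] with t ht
  simp [ht]

theorem integral_posLog_norm_one_add_mul_exp {a : ℝ} (ha : a ∈ Set.Ioc (0 : ℝ) 2) :
    ∫ t in (0 : ℝ)..2 * Real.pi, Real.posLog ‖1 + a * Complex.exp (t * Complex.I)‖ =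
      ∫ t in (0 : ℝ)..Real.arccos (-a / 2), Real.log (1 + a ^ 2 + 2 * a * Real.cos t) := by
  obtain ⟨ha0, ha2⟩ := ha
  set f : ℝ → ℝ := fun t => Real.posLog ‖1 + a * Complex.exp (t * Complex.I)‖ with hf
  have hfc : Continuous f := continuous_posLog_norm_one_add_mul_exp a
  have hnorm : ∀ t : ℝ, ‖1 + a * Complex.exp (t * Complex.I)‖ =
      √(1 + a ^ 2 + 2 * a * Real.cos t) := fun t => by
    rw [← norm_one_add_mul_exp_sq, Real.sqrt_sq (norm_nonneg _)]
  have hper : Function.Periodic f (2 * Real.pi) := fun t => by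
    simp only [hf, hnorm, Real.cos_add_two_pi]
  have heven : ∀ t, f (-t) = f t := fun t => by simp only [hf, hnorm, Real.cos_neg]
  have hc := Real.cos_arccos (x := -a / 2) (by linarith) (by linarith)
  -- Past the arccosine, `cos t ≤ -a / 2` forces `‖z‖ ≤ 1`, so `log⁺` vanishes.
  have hmid : ∫ t in (Real.arccos (-a / 2))..Real.pi, f t = 0 := by
    rw [intervalIntegral.integral_congr (g := fun _ => 0), intervalIntegral.integral_zero]
    intro t ht
    rw [Set.uIcc_of_le (Real.arccos_le_pi _)] at ht
    have := Real.cos_le_cos_of_nonneg_of_le_pi (Real.arccos_nonneg _) ht.2 ht.1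
    rw [hc] at this
    refine (Real.posLog_eq_zero_iff _).2 ?_
    rw [hnorm, abs_of_nonneg (Real.sqrt_nonneg _), Real.sqrt_le_one]
    nlinarith
  have hleft : ∫ t in (0 : ℝ)..Real.arccos (-a / 2), f t =
      2⁻¹ * ∫ t in (0 : ℝ)..Real.arccos (-a / 2),
        Real.log (1 + a ^ 2 + 2 * a * Real.cos t) := by
    rw [← intervalIntegral.integral_const_mul]
    refine intervalIntegral.integral_congr fun t ht => ?_
    rw [Set.uIcc_of_le (Real.arccos_nonneg _)] at ht
    have := Real.cos_le_cos_of_nonneg_of_le_pi ht.1 (Real.arccos_le_pi _) ht.2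
    rw [hc] at this
    have h1 : 1 ≤ 1 + a ^ 2 + 2 * a * Real.cos t := by nlinarith
    simp only [hf]
    rw [hnorm, Real.posLog_eq_log, Real.log_sqrt (by linarith)]
    swap
    · rw [abs_of_nonneg (Real.sqrt_nonneg _)]
      exact Real.one_le_sqrt.2 h1
    ring
  -- Moving to `[-π, π]` lets evenness double the integral over `[0, π]`, cancelling the `2⁻¹` that
  -- came from the square root.
  have hshift := hper.intervalIntegral_add_eq 0 (-Real.pi)
  rw [zero_add, (by ring : -Real.pi + 2 * Real.pi = Real.pi)] at hshift
  have hneg : ∫ t in (-Real.pi)..0, f t = ∫ t in (0 : ℝ)..Real.pi, f t := by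
    have := intervalIntegral.integral_comp_neg (a := 0) (b := Real.pi) f
    simp_rw [heven, neg_zero] at this
    exact this.symm
  have hint := fun u v : ℝ => hfc.intervalIntegrable (μ := MeasureTheory.volume) u v
  rw [hshift, ← intervalIntegral.integral_add_adjacent_intervals (hint _ 0) (hint _ _), hneg,
    ← intervalIntegral.integral_add_adjacent_intervals (hint 0 (Real.arccos (-a / 2))) (hint _ _),
    hmid, hleft]
  ring

theorem theorem1p2 (a : ℝ) (ha : a ∈ Set.Ioc (0 : ℝ) 2) :
    (∀ n : ℕ, 2 ≤ n →
      prodRootsOutside (unitTrinomial a n) = ((unitTrinomial a n).mahlerMeasure : ℂ)) ∧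
    Filter.Tendsto (fun n : ℕ => prodRootsOutside (unitTrinomial a n)) Filter.atTop
      (nhds ((Real.exp ((1 / (2 * Real.pi)) *
        ∫ t in (0 : ℝ)..Real.arccos (-a / 2),
          Real.log (1 + a ^ 2 + 2 * a * Real.cos t)) : ℝ) : ℂ)) := by
  refine ⟨fun n hn => prodRootsOutside_unitTrinomial ha hn, ?_⟩
  have hlim := (Real.continuous_exp.tendsto _).comp
    (tendsto_logMahlerMeasure_unitTrinomial ha.1.ne')
  rw [integral_posLog_norm_one_add_mul_exp ha, ← one_div] at hlim
  refine ((Complex.continuous_ofReal.tendsto _).comp hlim).congr' ?_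
  filter_upwards [Filter.eventually_ge_atTop 2] with n hn
  rw [prodRootsOutside_unitTrinomial ha hn, Function.comp_apply, Function.comp_apply,
    Polynomial.logMahlerMeasure_eq_log_MahlerMeasure,
    Real.exp_log (Polynomial.mahlerMeasure_pos_of_ne_zero (unitTrinomial_monic a hn).ne_zero)]
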